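/- Let $(V,g)$ be a real vector space of dimension $2n\ge 4$ with a positive definite inner product, and let $\mathcal T=\{K\in \mathrm{End}\,V : K^2=-\mathbb 1,\ g(K\cdot,K\cdot)=g(\cdot,\cdot)\}$ be its twistor space, a submanifold of $\mathrm{End}\,V$ with tangent spaces $T_K\mathcal T=\{A\in\mathfrak o(V,g) : AK+KA=0\}$. Let $\phi$ be the tautological section $\phi|_K=K$ of the trivial bundle $\mathrm{End}\,V\times\mathcal T$, fix $J\in\mathcal T$, regarded also as a constant section, and write $\{J,\phi\}=J\phi+\phi J$ and $[J,\phi]=J\phi-\phi J$. A *skew algebroid* $(E,[\cdot,\cdot],\psi)$ on $\mathcal T$ is a smooth vector bundle $E$ over $\mathcal T$ with an $\mathbb R$-bilinear skew-symmetric bracket on the space $\Gamma(E)$ of smooth sections and a smooth bundle map $\psi:E\to T\mathcal T$ such that, for all $A,B\in\Gamma(E)$ and $f\in C^\infty(\mathcal T)$, $$\psi([A,B])=[\psi(A),\psi(B)]_{\mathrm{Lie}},\qquad [A,fB]=f[A,B]+\psi(A)[f]\,B.$$ Let $S\in\{\mathbb 1,\ J+\phi,\ J-\phi,\ [J,\phi]\}$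 and $E=\mathfrak u(\mathbb V,J)$, the bundle over $\mathcal T$ with constant fibre $\{A\in\mathfrak o(V,g): JA=AJ\}$. Let $\tilde\gamma,\tilde\delta$ be the unique elements of $\{\pm J,\pm\phi\}$ such that $JS=S\tilde\gamma$ and $SJ=\tilde\delta S$, as sections over $\mathcal T$, and let $E^S$ be the bundle with fibre $\{B\in\mathfrak o(V,g):\tilde\gamma|_K B=B\,\tilde\delta|_K\}$ at $K\in\mathcal T$. Define functions $f_1,\dots,f_{2n}$ on $\mathcal T$ by $$\det(\lambda\mathbb 1-\{J,\phi\})=\lambda^{2n}-f_1\lambda^{2n-1}+\dots-f_{2n-1}\lambda+f_{2n}.$$ Let $Q=a_k\{J,\phi\}^k+\dots+a_1\{J,\phi\}+a_0\mathbb 1$ with each $a_i\in\mathbb R[f_1,\dots,f_{2n}]$, put $F=QS$, and define $\psi$ on $E^S$ by $\psi(A)=[FAF,\phi]$. Then there exists a bracket $[\cdot,\cdot]_F$ on $\Gamma(E^S)$ such that $(E^S,[\cdot,\cdot]_F,\psi)$ is a skew algebroid on $\mathcal T$. -/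

import Mathlib

open Module Filter
open scoped ContDiff Topology InnerProductSpace

set_option linter.unusedSimpArgs false
set_option linter.unusedSectionVars false

namespace TwistorSpace

/-! Throughout, the metric `g` on `V` is the inner product of `V`, and `End V` is the normed algebra
`V →L[ℝ] V` (every endomorphism of a finite-dimensional space is continuous). -/

/-- The twistor space `𝒯(V,g)`, as a subset of the vector space `End V`. -/
def twistorSet (V : Type*) [NormedAddCommGroup V] [InnerProductSpace ℝ V] : Set (V →L[ℝ] V) :=
  {K | K * K = -1 ∧ ∀ x y : V, ⟪K x, K y⟫_ℝ = ⟪x, y⟫_ℝ}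

/-- The points of the twistor space. -/
abbrev Twistor (V : Type*) [NormedAddCommGroup V] [InnerProductSpace ℝ V] : Type _ :=
  ↥(twistorSet V)

section

variable {V : Type*} [NormedAddCommGroup V] [InnerProductSpace ℝ V]
  {F : Type*} [NormedAddCommGroup F] [NormedSpace ℝ F]

/-- Extension by zero to `End V` of a map that is defined on the twistor space. Only its values on
the twistor space are ever used. -/
noncomputable def ext (s : Twistor V → F) : (V →L[ℝ] V) → F :=
  Function.extend Subtype.val s 0

/-- A map on the twistor space, viewed as a submanifold of `End V`, is smooth. (Near each point the
twistor space is a smooth retract of an open subset of `End V`; so this says that the map is locally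
the restriction of a smooth map on an open subset of `End V`.) -/
def IsSmooth (s : Twistor V → F) : Prop := ContDiffOn ℝ ∞ (ext s) (twistorSet V)

/-- The derivative `ds_X` at `K` of a map on the twistor space, in the direction of a vector `X`
tangent to the twistor space at `K`. (Two derivatives of `s` within the twistor space agree on the
vectors tangent to it, so this does not depend on choices for such `X`.) -/
noncomputable def dAlong (s : Twistor V → F) (K : Twistor V) (X : V →L[ℝ] V) : F :=
  fderivWithin ℝ (ext s) (twistorSet V) K X

/-- The Lie bracket `[X,Y] = dY_X - dX_Y` of vector fields on the twistor space. -/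
noncomputable def lieBracket (X Y : Twistor V → (V →L[ℝ] V)) : Twistor V → (V →L[ℝ] V) :=
  fun K => dAlong Y K (X K) - dAlong X K (Y K)

theorem ext_apply (s : Twistor V → F) (K : Twistor V) : ext s K = s K :=
  Subtype.val_injective.extend_apply _ _ _

theorem isSmooth_congr {s : Twistor V → F} {h : (V →L[ℝ] V) → F}
    (hh : ContDiffOn ℝ ∞ h (twistorSet V)) (e : ∀ K : Twistor V, s K = h K) : IsSmooth s :=
  hh.congr fun K hK => (ext_apply s ⟨K, hK⟩).trans (e ⟨K, hK⟩)

theorem IsSmooth.add {s t : Twistor V → F} (hs : IsSmooth s) (ht : IsSmooth t) :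
    IsSmooth (s + t) :=
  isSmooth_congr (ContDiffOn.add hs ht) fun K => by simp [ext_apply]

theorem IsSmooth.smul {f : Twistor V → ℝ} {s : Twistor V → F} (hf : IsSmooth f)
    (hs : IsSmooth s) : IsSmooth (f • s) :=
  isSmooth_congr (ContDiffOn.smul hf hs) fun K => by simp [ext_apply]

theorem isSmooth_const (c : F) : IsSmooth (V := V) fun _ => c :=
  isSmooth_congr (contDiffOn_const (c := c)) fun _ => rfl

/-- The algebra `C^∞(𝒯)` of smooth real functions on the twistor space. -/
def smoothFun (V : Type*) [NormedAddCommGroup V] [InnerProductSpace ℝ V] :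
    Subalgebra ℝ (Twistor V → ℝ) where
  carrier := {f | IsSmooth f}
  mul_mem' hf hg := IsSmooth.smul hf hg
  add_mem' hf hg := IsSmooth.add hf hg
  algebraMap_mem' c := isSmooth_const c

/-- The Lie algebra `𝔬(V,g)` of skew endomorphisms. -/
def orth (V : Type*) [NormedAddCommGroup V] [InnerProductSpace ℝ V] :
    Submodule ℝ (V →L[ℝ] V) where
  carrier := {A | ∀ x y : V, ⟪A x, y⟫_ℝ = -⟪x, A y⟫_ℝ}
  add_mem' hA hB x y := by
    simp only [_root_.add_apply, inner_add_left, inner_add_right, hA x y, hB x y]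
    ring
  zero_mem' x y := by simp
  smul_mem' c A hA x y := by
    simp only [_root_.smul_apply, real_inner_smul_left, real_inner_smul_right, hA x y]
    ring

/-- The tangent space `T_K 𝒯 = {A ∈ 𝔬(V,g) | AK + KA = 0}`. -/
def tangent (K : Twistor V) : Submodule ℝ (V →L[ℝ] V) where
  carrier := {A | A ∈ orth V ∧ A * (K : V →L[ℝ] V) + K * A = 0}
  add_mem' {A B} hA hB := ⟨add_mem hA.1 hB.1, by
    rw [add_mul, mul_add, add_add_add_comm, hA.2, hB.2, add_zero]⟩
  zero_mem' := ⟨zero_mem _, by simp⟩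
  smul_mem' c A hA := ⟨Submodule.smul_mem _ c hA.1, by
    rw [smul_mul_assoc, mul_smul_comm, ← smul_add, hA.2, smul_zero]⟩

/-- The space `Γ(E)` of smooth sections of a family `E` of linear subspaces of `End V` that is
indexed by the twistor space. -/
def Sections (E : Twistor V → Submodule ℝ (V →L[ℝ] V)) :
    Submodule ℝ (Twistor V → (V →L[ℝ] V)) where
  carrier := {s | IsSmooth s ∧ ∀ K, s K ∈ E K}
  add_mem' hs ht := ⟨hs.1.add ht.1, fun K => add_mem (hs.2 K) (ht.2 K)⟩
  zero_mem' := ⟨isSmooth_const 0, fun _ => zero_mem _⟩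
  smul_mem' c _ hs := ⟨(isSmooth_const c).smul hs.1, fun K => (E K).smul_mem c (hs.2 K)⟩

/-- The product of a smooth function and a section. -/
instance (E : Twistor V → Submodule ℝ (V →L[ℝ] V)) : SMul (smoothFun V) (Sections E) where
  smul f B := ⟨fun K => f.1 K • B.1 K,
    IsSmooth.smul f.2 B.2.1, fun K => (E K).smul_mem (f.1 K) (B.2.2 K)⟩

/-- The family `E` is a smooth vector subbundle of the trivial bundle `End V × 𝒯`: near each point
there is a frame of smooth sections. -/
def IsVectorBundle (E : Twistor V → Submodule ℝ (V →L[ℝ] V)) : Prop :=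
  ∀ K : Twistor V, ∃ (r : ℕ) (s : Fin r → Sections E), ∀ᶠ L in 𝓝 K,
    LinearIndependent ℝ (fun i => (s i).1 L) ∧
      Submodule.span ℝ (Set.range fun i => (s i).1 L) = E L

/-- `(E, [·,·], ψ)` is a skew algebroid on the twistor space, where `[·,·]` is an `ℝ`-bilinear
bracket on `Γ(E)` and where `ψ` is given on the fibre `E K` by a linear map `ψ K`. -/
structure IsSkewAlgebroid (E : Twistor V → Submodule ℝ (V →L[ℝ] V))
    (br : Sections E →ₗ[ℝ] Sections E →ₗ[ℝ] Sections E)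
    (ψ : Twistor V → (V →L[ℝ] V) →ₗ[ℝ] (V →L[ℝ] V)) : Prop where
  isVectorBundle : IsVectorBundle E
  /-- `ψ` maps `E` to the tangent bundle. -/
  anchor_mem : ∀ K, ∀ A ∈ E K, ψ K A ∈ tangent K
  /-- `ψ` is smooth. -/
  anchor_smooth : ∀ A : Sections E, IsSmooth fun K => ψ K (A.1 K)
  skew : ∀ A B, br A B = -br B A
  anchor_bracket : ∀ A B : Sections E,
    (fun K => ψ K ((br A B).1 K)) = lieBracket (fun K => ψ K (A.1 K)) (fun K => ψ K (B.1 K))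
  leibniz : ∀ (A B : Sections E) (f : smoothFun V),
    (br A (f • B)).1 = fun K => f.1 K • (br A B).1 K + dAlong f.1 K (ψ K (A.1 K)) • B.1 K

/-- The tautological section `φ`, with `φ|_K = K`. -/
def φ : Twistor V → (V →L[ℝ] V) := fun K => K

/-- The constant section `J`. -/
def cst (J : Twistor V) : Twistor V → (V →L[ℝ] V) := fun _ => J

/-- The set `{1, J + φ, J - φ, [J,φ]}` of sections of `End V × 𝒯`. -/
def sSet (J : Twistor V) : Set (Twistor V → (V →L[ℝ] V)) :=
  {1, cst J + φ, cst J - φ, cst J * φ - φ * cst J}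

/-- The set `{J, -J, φ, -φ}` of sections of `End V × 𝒯`. -/
def letters (J : Twistor V) : Set (Twistor V → (V →L[ℝ] V)) :=
  {cst J, -cst J, φ, -φ}

/-- The bundle `E = {A ∈ 𝔬(V,g) | γ A = A δ}`. In particular, `𝔲(V,J)` is `bundle (cst J) (cst J)`. -/
def bundle (γ δ : Twistor V → (V →L[ℝ] V)) (K : Twistor V) : Submodule ℝ (V →L[ℝ] V) where
  carrier := {A | A ∈ orth V ∧ γ K * A = A * δ K}
  add_mem' {A B} hA hB := ⟨add_mem hA.1 hB.1, by rw [mul_add, add_mul, hA.2, hB.2]⟩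
  zero_mem' := ⟨zero_mem _, by simp⟩
  smul_mem' c A hA := ⟨Submodule.smul_mem _ c hA.1, by
    rw [mul_smul_comm, smul_mul_assoc, hA.2]⟩

/-- The bundle `E^S` of `E = bundle γ δ`: it is `bundle γ' δ'` for the elements `γ'`, `δ'` of
`{J, -J, φ, -φ}` with `γ S = S γ'` and `S δ = δ' S`. When `dim V ≥ 4`, these exist and are unique,
see `existsUnique_left` and `existsUnique_right` below. -/
def bundleS (J : Twistor V) (S γ δ : Twistor V → (V →L[ℝ] V)) (K : Twistor V) :
    Submodule ℝ (V →L[ℝ] V) :=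
  ⨅ (γ' ∈ letters J) (δ' ∈ letters J) (_ : γ * S = S * γ') (_ : S * δ = δ' * S), bundle γ' δ' K

/-- The section `{J,φ} = Jφ + φJ`. -/
def anti (J : Twistor V) : Twistor V → (V →L[ℝ] V) := cst J * φ + φ * cst J

/-- The functions `f_j` on the twistor space with
`det(λ1 - {J,φ}) = λ^{2n} - f_1 λ^{2n-1} + ... - f_{2n-1} λ + f_{2n}`, where `dim V = 2n`. -/
noncomputable def symFun [FiniteDimensional ℝ V] (J : Twistor V) (n j : ℕ) : Twistor V → ℝ := fun K =>
  (-1) ^ j * (LinearMap.charpoly (anti J K : V →ₗ[ℝ] V)).coeff (2 * n - j)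

/-- The section `Q = a_k {J,φ}^k + ... + a_1 {J,φ} + a_0 1`. -/
noncomputable def polyQ (J : Twistor V) (k : ℕ) (a : ℕ → Twistor V → ℝ) :
    Twistor V → (V →L[ℝ] V) :=
  fun K => ∑ i ∈ Finset.range (k + 1), a i K • anti J K ^ i

/-- The map `ψ`, given at `K` by `A ↦ [F A F, φ]`. -/
noncomputable def anchor (F : Twistor V → (V →L[ℝ] V)) (K : Twistor V) :
    (V →L[ℝ] V) →ₗ[ℝ] (V →L[ℝ] V) where
  toFun A := F K * A * F K * φ K - φ K * (F K * A * F K)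
  map_add' A B := by simp only [mul_add, add_mul]; abel
  map_smul' c A := by simp [smul_sub]

/-! The elements `γ'` and `δ'` in the definition of `E^S` exist and are unique. -/

theorem sq_eq (K : Twistor V) : (K : V →L[ℝ] V) * K = -1 := K.2.1

theorem mem_orth (K : Twistor V) : (K : V →L[ℝ] V) ∈ orth V := fun x y => by
  rw [← K.2.2 x, ← mul_apply_eq_comp, K.2.1]
  simp

theorem exists_tilde (J : Twistor V) {S γ : Twistor V → (V →L[ℝ] V)} (hS : S ∈ sSet J)
    (hγ : γ ∈ letters J) : ∃ γ' ∈ letters J, γ * S = S * γ' ∧ S * γ = γ' * S := by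
  have h1 : cst J * cst J = -1 := funext fun _ => sq_eq J
  have h2 : (φ : Twistor V → (V →L[ℝ] V)) * φ = -1 := funext fun K => sq_eq K
  have h3 : ∀ x, cst J * (cst J * x) = -x := fun x => by rw [← mul_assoc, h1, neg_one_mul]
  have h4 : ∀ x : Twistor V → (V →L[ℝ] V), φ * (φ * x) = -x := fun x => by
    rw [← mul_assoc, h2, neg_one_mul]
  simp only [sSet, letters, Set.mem_insert_iff, Set.mem_singleton_iff] at hS hγ
  have key : ∀ c : Twistor V → (V →L[ℝ] V), c = cst J ∨ c = φ →
      ∃ γ' ∈ letters J, -γ' ∈ letters J ∧ c * S = S * γ' ∧ S * c = γ' * S := by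
    have m1 : cst J ∈ letters J := by simp [letters]
    have m2 : -cst J ∈ letters J := by simp [letters]
    have m3 : φ ∈ letters J := by simp [letters]
    have m4 : -φ ∈ letters J := by simp [letters]
    have m5 : - -cst J ∈ letters J := by simp [letters]
    have m6 : - -φ ∈ letters J := by simp [letters]
    rintro c (rfl | rfl) <;> rcases hS with rfl | rfl | rfl | rfl
    · exact ⟨_, m1, m2, by simp, by simp⟩
    · exact ⟨_, m3, m4, by simp only [mul_add, add_mul, h1, h2]; abel,
        by simp only [mul_add, add_mul, h1, h2]; abel⟩
    · exact ⟨_, m4, m6, by simp only [mul_sub, sub_mul, h1, h2, mul_neg, neg_mul]; abel,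
        by simp only [mul_sub, sub_mul, h1, h2, mul_neg, neg_mul]; abel⟩
    · exact ⟨_, m2, m5,
        by simp only [mul_sub, sub_mul, h1, h2, h3, mul_neg, neg_mul, mul_assoc, mul_one]; abel,
        by simp only [mul_sub, sub_mul, h1, h2, h3, mul_neg, neg_mul, mul_assoc, mul_one]; abel⟩
    · exact ⟨_, m3, m4, by simp, by simp⟩
    · exact ⟨_, m1, m2, by simp only [mul_add, add_mul, h1, h2]; abel,
        by simp only [mul_add, add_mul, h1, h2]; abel⟩
    · exact ⟨_, m2, m5, by simp only [mul_sub, sub_mul, h1, h2, mul_neg, neg_mul]; abel,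
        by simp only [mul_sub, sub_mul, h1, h2, mul_neg, neg_mul]; abel⟩
    · exact ⟨_, m4, m6,
        by simp only [mul_sub, sub_mul, h1, h2, h4, mul_neg, neg_mul, mul_assoc, mul_one]; abel,
        by simp only [mul_sub, sub_mul, h1, h2, h4, mul_neg, neg_mul, mul_assoc, mul_one]; abel⟩
  rcases hγ with rfl | rfl | rfl | rfl
  · obtain ⟨x, hx, -, hy, hz⟩ := key _ (Or.inl rfl)
    exact ⟨x, hx, hy, hz⟩
  · obtain ⟨x, -, hx, hy, hz⟩ := key _ (Or.inl rfl)
    exact ⟨-x, hx, by rw [neg_mul, mul_neg, hy], by rw [neg_mul, mul_neg, hz]⟩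
  · obtain ⟨x, hx, -, hy, hz⟩ := key _ (Or.inr rfl)
    exact ⟨x, hx, hy, hz⟩
  · obtain ⟨x, -, hx, hy, hz⟩ := key _ (Or.inr rfl)
    exact ⟨-x, hx, by rw [neg_mul, mul_neg, hy], by rw [neg_mul, mul_neg, hz]⟩

theorem conj_mem (K : Twistor V) (R : V ≃ₗᵢ[ℝ] V) :
    (R : V →L[ℝ] V) * K * (R.symm : V →L[ℝ] V) ∈ twistorSet V := by
  refine ⟨?_, fun x y => ?_⟩
  · ext x
    have h : ∀ y, (K : V →L[ℝ] V) ((K : V →L[ℝ] V) y) = -y := fun y =>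
      DFunLike.congr_fun K.2.1 y
    simp [h]
  · have h := K.2.2 (R.symm x) (R.symm y)
    simpa using h

theorem exists_comm_ne (hdim : 4 ≤ finrank ℝ V) (J : Twistor V) :
    ∃ K : Twistor V, (J : V →L[ℝ] V) * K - K * J ≠ 0 := by
  have : FiniteDimensional ℝ V := FiniteDimensional.of_finrank_pos (by omega)
  have : Nontrivial V := Module.nontrivial_of_finrank_pos (R := ℝ) (by omega)
  have hsk := mem_orth J
  have hsq : ∀ y, (J : V →L[ℝ] V) ((J : V →L[ℝ] V) y) = -y := fun y => DFunLike.congr_fun J.2.1 y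
  set j : V →L[ℝ] V := J.1 with hj
  have hself : ∀ x, ⟪x, j x⟫_ℝ = 0 := fun x => by
    have h1 := hsk x x
    rw [real_inner_comm] at h1
    linarith
  obtain ⟨e, he⟩ := exists_norm_eq V (zero_le_one' ℝ)
  classical
  obtain ⟨f, hf, hef, hjf⟩ : ∃ f : V, ‖f‖ = 1 ∧ ⟪e, f⟫_ℝ = 0 ∧ ⟪j e, f⟫_ℝ = 0 := by
    let W : Submodule ℝ V := Submodule.span ℝ (({e, j e} : Finset V) : Set V)
    have hW : finrank ℝ W ≤ 2 := (finrank_span_finset_le_card _).trans Finset.card_le_two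
    have hsum := W.finrank_add_finrank_orthogonal
    have : Nontrivial Wᗮ := Module.nontrivial_of_finrank_pos (R := ℝ) (by omega)
    obtain ⟨f, hf⟩ := exists_norm_eq Wᗮ (zero_le_one' ℝ)
    have hm := W.mem_orthogonal (f : V) |>.1 f.2
    exact ⟨f, by simpa using hf, hm e (Submodule.subset_span (by simp)),
      hm (j e) (Submodule.subset_span (by simp))⟩
  have hejf : ⟪e, j f⟫_ℝ = 0 := by have := hsk e f; linarith
  have hperp : ∀ u v : V, ⟪u, v⟫_ℝ = 0 → (ℝ ∙ u)ᗮ.reflection v = v := fun u v h =>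
    Submodule.reflection_mem_subspace_eq_self (Submodule.mem_orthogonal_singleton_iff_inner_right.2 h)
  let a := (ℝ ∙ e)ᗮ.reflection
  let b := (ℝ ∙ (e - -f))ᗮ.reflection
  have ae : a e = -e := Submodule.reflection_orthogonalComplement_singleton_eq_neg e
  have af : a f = f := hperp _ _ hef
  have aje : a (j e) = j e := hperp _ _ (hself e)
  have ajf : a (j f) = j f := hperp _ _ hejf
  have be : b e = -f := Submodule.reflection_sub (by rw [norm_neg, he, hf])
  have bf : b f = -e := by
    have h : b (b e) = e := Submodule.reflection_reflection _ e
    rw [be, map_neg] at h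
    rw [← h, neg_neg]
  have bje : b (j e) = j e := hperp _ _ (by
    rw [sub_neg_eq_add, inner_add_left, hself, real_inner_comm, hjf, add_zero])
  have bjf : b (j f) = j f := hperp _ _ (by
    rw [sub_neg_eq_add, inner_add_left, hself, hejf, add_zero])
  refine ⟨⟨_, conj_mem J (b.trans a)⟩, fun h => ?_⟩
  have asymm : a.symm = a := Submodule.reflection_symm
  have bsymm : b.symm = b := Submodule.reflection_symm
  have h2 := DFunLike.congr_fun h e
  have ke : (((b.trans a : V ≃ₗᵢ[ℝ] V) : V →L[ℝ] V) * j *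
      ((b.trans a).symm : V →L[ℝ] V)) e = j f := by
    change a (b (j (b.symm (a.symm e)))) = j f
    rw [asymm, bsymm, ae, map_neg, be, neg_neg, bjf, ajf]
  have kje : (((b.trans a : V ≃ₗᵢ[ℝ] V) : V →L[ℝ] V) * j *
      ((b.trans a).symm : V →L[ℝ] V)) (j e) = f := by
    change a (b (j (b.symm (a.symm (j e))))) = f
    rw [asymm, bsymm, aje, bje, hsq, map_neg, be, neg_neg, af]
  have h3 : j (j f) - f = 0 := by
    refine Eq.trans ?_ h2
    change _ = j _ - _
    congr 1
    · exact congr_arg j ke.symm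
    · exact kje.symm
  rw [hsq] at h3
  have h4 : (2 : ℝ) • f = 0 := by rw [two_smul]; rw [← neg_eq_zero, ← h3]; abel
  have h5 : f = 0 := (smul_eq_zero.1 h4).resolve_left two_ne_zero
  rw [h5, norm_zero] at hf
  exact zero_ne_one hf

theorem eq_zero_of_mul_self {A : V →L[ℝ] V} (hA : A ∈ orth V) (h : A * A = 0) : A = 0 := by
  ext x
  have h1 := hA x (A x)
  have h2 : A (A x) = 0 := DFunLike.congr_fun h x
  rw [h2, inner_zero_right, neg_zero] at h1
  exact inner_self_eq_zero.1 h1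

theorem comm_mem_orth (J K : Twistor V) : (J : V →L[ℝ] V) * K - K * J ∈ orth V := fun x y => by
  simp only [sub_apply, mul_apply_eq_comp, inner_sub_left, inner_sub_right,
    mem_orth J _ y, mem_orth K _ y, mem_orth J x, mem_orth K x]
  ring

theorem exists_factor (J K : Twistor V) {S : Twistor V → (V →L[ℝ] V)} (hS : S ∈ sSet J) :
    ∃ T T' : V →L[ℝ] V, T * S K = (J : V →L[ℝ] V) * K - K * J ∧
      S K * T' = (J : V →L[ℝ] V) * K - K * J := by
  have hj := sq_eq J
  have hk := sq_eq K
  simp only [sSet, Set.mem_insert_iff, Set.mem_singleton_iff] at hS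
  rcases hS with rfl | rfl | rfl | rfl
  · exact ⟨_, _, mul_one _, one_mul _⟩
  · refine ⟨J - K, K - J, ?_, ?_⟩ <;>
      simp only [cst, φ, Pi.add_apply, mul_add, add_mul, mul_sub, sub_mul, hj, hk] <;> abel
  · refine ⟨-(J + K), J + K, ?_, ?_⟩ <;>
      simp only [cst, φ, Pi.sub_apply, mul_add, add_mul, mul_sub, sub_mul, neg_mul, hj, hk] <;> abel
  · exact ⟨1, 1, one_mul _, mul_one _⟩

/-- Different elements of `{J, -J, φ, -φ}` stay different after composition with `S`. -/
theorem eq_of_mul (hdim : 4 ≤ finrank ℝ V) (J : Twistor V) {S γ δ : Twistor V → (V →L[ℝ] V)}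
    (hS : S ∈ sSet J) (hγ : γ ∈ letters J) (hδ : δ ∈ letters J)
    (h : S * γ = S * δ ∨ γ * S = δ * S) : γ = δ := by
  obtain ⟨K, hK⟩ := exists_comm_ne hdim J
  obtain ⟨T, T', hT, hT'⟩ := exists_factor J K hS
  have hcc := fun h => hK (eq_zero_of_mul_self (comm_mem_orth J K) h)
  have hj := sq_eq J
  have hk := sq_eq K
  have sq : ∀ x ∈ letters J, x K * x K = -1 := fun x hx => by
    simp only [letters, Set.mem_insert_iff, Set.mem_singleton_iff] at hx
    rcases hx with rfl | rfl | rfl | rfl <;> simp [cst, φ, hj, hk]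
  set c : V →L[ℝ] V := (J : V →L[ℝ] V) * K - K * J with hc
  have hcD : c * (γ K - δ K) = 0 ∨ (γ K - δ K) * c = 0 := by
    rcases h with h | h
    · left
      have := congr_fun h K
      simp only [Pi.mul_apply] at this
      rw [← hT, mul_assoc, mul_sub, this, sub_self, mul_zero]
    · right
      have := congr_fun h K
      simp only [Pi.mul_apply] at this
      rw [← hT', ← mul_assoc, sub_mul, this, sub_self, zero_mul]
  have opp : γ ≠ -δ := fun h => hK <| by
    have h2 : γ K = -δ K := congr_fun h K
    have h3 : (γ K - δ K) * δ K = (2 : ℝ) • 1 := by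
      rw [h2, sub_mul, neg_mul, sq δ hδ, two_smul]; abel
    have h4 : δ K * (γ K - δ K) = (2 : ℝ) • 1 := by
      rw [h2, mul_sub, mul_neg, sq δ hδ, two_smul]; abel
    have h5 : (2 : ℝ) • c = 0 := by
      rcases hcD with h | h
      · rw [← mul_one c, ← mul_smul_comm, ← h3, ← mul_assoc, h, zero_mul]
      · rw [← one_mul c, ← smul_mul_assoc, ← h4, mul_assoc, h, mul_zero]
    exact (smul_eq_zero.1 h5).resolve_left two_ne_zero
  have comm : γ K * δ K - δ K * γ K ≠ c ∧ γ K * δ K - δ K * γ K ≠ -c := by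
    have h3 : (γ K - δ K) * (γ K + δ K) = γ K * δ K - δ K * γ K := by
      rw [sub_mul, mul_add, mul_add, sq γ hγ, sq δ hδ]; abel
    have h4 : (γ K + δ K) * (γ K - δ K) = -(γ K * δ K - δ K * γ K) := by
      rw [add_mul, mul_sub, mul_sub, sq γ hγ, sq δ hδ]; abel
    have h5 : c * (γ K * δ K - δ K * γ K) = 0 ∨ (γ K * δ K - δ K * γ K) * c = 0 := by
      rcases hcD with h | h
      · left; rw [← h3, ← mul_assoc, h, zero_mul]
      · right; rw [← neg_eq_zero, ← neg_mul, ← h4, mul_assoc, h, mul_zero]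
    constructor <;> intro h <;> rw [h] at h5 <;> apply hcc <;> simpa using h5
  simp only [letters, Set.mem_insert_iff, Set.mem_singleton_iff] at hγ hδ
  rcases hγ with rfl | rfl | rfl | rfl <;> rcases hδ with rfl | rfl | rfl | rfl <;>
    first
    | rfl
    | (refine absurd ?_ opp; simp; done)
    | (refine absurd ?_ comm.1
       simp only [cst, φ, Pi.neg_apply, neg_mul, mul_neg, neg_neg, hc]; done)
    | (refine absurd ?_ comm.1
       simp only [cst, φ, Pi.neg_apply, neg_mul, mul_neg, neg_neg, hc]; abel1)
    | (refine absurd ?_ comm.2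
       simp only [cst, φ, Pi.neg_apply, neg_mul, mul_neg, neg_neg, hc]; abel1)

theorem existsUnique_left (hdim : 4 ≤ finrank ℝ V) (J : Twistor V)
    {S γ : Twistor V → (V →L[ℝ] V)} (hS : S ∈ sSet J) (hγ : γ ∈ letters J) :
    ∃! γ', γ' ∈ letters J ∧ γ * S = S * γ' := by
  obtain ⟨γ', h, h1, -⟩ := exists_tilde J hS hγ
  exact ⟨γ', ⟨h, h1⟩, fun δ hδ => eq_of_mul hdim J hS hδ.1 h (Or.inl (hδ.2.symm.trans h1))⟩

theorem existsUnique_right (hdim : 4 ≤ finrank ℝ V) (J : Twistor V)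
    {S δ : Twistor V → (V →L[ℝ] V)} (hS : S ∈ sSet J) (hδ : δ ∈ letters J) :
    ∃! δ', δ' ∈ letters J ∧ S * δ = δ' * S := by
  obtain ⟨γ', h, -, h1⟩ := exists_tilde J hS hδ
  exact ⟨γ', ⟨h, h1⟩, fun δ hδ => eq_of_mul hdim J hS hδ.1 h (Or.inr (hδ.2.symm.trans h1))⟩

end

end TwistorSpace

open TwistorSpace

/-! The same letter `c` satisfies `JS = Sc` and `SJ = cS`, so `E^S` is the bundle of skew
endomorphisms that commute with `c`. Since `Q` is a polynomial in `{J,φ}`, which commutes with `J`,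
`φ` and `S`, also `JF = Fc`, `FJ = cF` and `F* = ±F`. For `A` in `E^S` the endomorphism `X_A = FAF`
therefore lies in `𝔲(V,J)`, and `ψ(A) = [X_A,φ]` is the velocity of conjugation by `exp(t X_A)`.
This flow fixes `J`, so it carries every section built naturally from `J` and `φ` along with it:
`F`, `c` and `φ` have derivative `[X_A, ·]` along `ψ(A)`.

Hence `D_A B = dB(ψ(A)) - [X_A,B]` is again a section of `E^S` (`dAlong_comm`), and the product rule
gives `d(ψ(B))(ψ(A)) = ψ(D_A B) + [X_A, ψ(B)]` (`dAlong_anchor`). After antisymmetrization the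
Jacobi identity leaves `[[X_A,X_B],φ]`, and `[X_A,X_B] = F(AF²B - BF²A)F`. So the bracket `D_A B -
D_B A + AF²B - BF²A` is carried by `ψ` to the Lie bracket (`anchor_bracketFun`). Its Leibniz rule
comes from the term `dB(ψ(A))` alone, everything else being linear over functions. -/

namespace TwistorSpace

/-! ### Differentiation on the twistor space along conjugation curves. -/

section Calculus

variable {V : Type*} [NormedAddCommGroup V] [InnerProductSpace ℝ V] [CompleteSpace V]
  {F : Type*} [NormedAddCommGroup F] [NormedSpace ℝ F]

theorem mem_orth_iff_star {A : V →L[ℝ] V} : A ∈ orth V ↔ star A = -A := by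
  rw [← neg_eq_iff_eq_neg, eq_comm, ← star_neg, ContinuousLinearMap.star_eq_adjoint,
    ContinuousLinearMap.eq_adjoint_iff]
  simp [orth]

theorem star_twistor (K : Twistor V) : star (K : V →L[ℝ] V) = -K :=
  mem_orth_iff_star.1 (mem_orth K)

theorem mem_twistorSet {K : V →L[ℝ] V} (h : K * K = -1) (hs : star K = -K) :
    K ∈ twistorSet V := by
  refine ⟨h, fun x y => ?_⟩
  rw [mem_orth_iff_star.2 hs, ← mul_apply_eq_comp, h]
  simp

theorem exp_mul_exp_neg (B : V →L[ℝ] V) : NormedSpace.exp B * NormedSpace.exp (-B) = 1 := by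
  let _ := NormedAlgebra.restrictScalars ℚ ℝ (V →L[ℝ] V)
  rw [← NormedSpace.exp_add_of_commute (Commute.refl B).neg_right, add_neg_cancel,
    NormedSpace.exp_zero]

theorem exp_neg_mul_exp (B : V →L[ℝ] V) : NormedSpace.exp (-B) * NormedSpace.exp B = 1 := by
  simpa using exp_mul_exp_neg (-B)

/-- The exponential of a skew endomorphism is orthogonal: its adjoint is `exp(-B)`, which is its
inverse. -/
theorem conj_exp_mem {B : V →L[ℝ] V} (hB : B ∈ orth V) (K : Twistor V) :
    NormedSpace.exp B * K * NormedSpace.exp (-B) ∈ twistorSet V := by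
  have hstar : star (NormedSpace.exp B) = NormedSpace.exp (-B) := by
    rw [NormedSpace.star_exp, mem_orth_iff_star.1 hB]
  have hstar' : star (NormedSpace.exp (-B)) = NormedSpace.exp B := by
    rw [← hstar, star_star]
  apply mem_twistorSet
  · calc _ = NormedSpace.exp B * K * (NormedSpace.exp (-B) * NormedSpace.exp B) * K *
          NormedSpace.exp (-B) := by simp only [mul_assoc]
      _ = _ := by
        rw [exp_neg_mul_exp, mul_one, mul_assoc _ (K : V →L[ℝ] V) K, sq_eq, mul_neg, mul_one, neg_mul,
          exp_mul_exp_neg]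
  · rw [star_mul, star_mul, hstar, hstar', star_twistor, mul_assoc]
    simp

/-- The curve `t ↦ exp(tB) K exp(-tB)` in the twistor space, for a skew endomorphism `B`. -/
noncomputable def conjCurve {B : V →L[ℝ] V} (hB : B ∈ orth V) (K : Twistor V) (t : ℝ) :
    Twistor V :=
  ⟨_, conj_exp_mem (Submodule.smul_mem _ t hB) K⟩

theorem conjCurve_zero {B : V →L[ℝ] V} (hB : B ∈ orth V) (K : Twistor V) :
    conjCurve hB K 0 = K := by
  ext1
  simp [conjCurve]

theorem hasDerivAt_conj_exp (B A : V →L[ℝ] V) :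
    HasDerivAt (fun t : ℝ => NormedSpace.exp (t • B) * A * NormedSpace.exp (-(t • B)))
      (B * A - A * B) 0 := by
  have h1 : HasDerivAt (fun t : ℝ => NormedSpace.exp (t • B)) B 0 := by
    simpa using hasDerivAt_exp_smul_const (𝕂 := ℝ) B (0 : ℝ)
  have h2 : HasDerivAt (fun t : ℝ => NormedSpace.exp (-(t • B))) (-B) 0 := by
    simpa using hasDerivAt_exp_smul_const (𝕂 := ℝ) (-B) (0 : ℝ)
  have h3 := (h1.mul_const A).mul h2
  simp only [zero_smul, neg_zero, NormedSpace.exp_zero, mul_one, one_mul, mul_neg,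
    ← sub_eq_add_neg] at h3
  exact h3

/-- The chain rule along a curve that stays in the twistor space. As `f` may be any derivative
within that set, its value on `[B,K]` is forced, although derivatives within the set need not be
unique on all of `End V`. -/
theorem HasFDerivWithinAt.hasDerivAt_conjCurve {s : Twistor V → F} {f : (V →L[ℝ] V) →L[ℝ] F}
    {K : Twistor V} (h : HasFDerivWithinAt (ext s) f (twistorSet V) K)
    {B : V →L[ℝ] V} (hB : B ∈ orth V) :
    HasDerivAt (fun t => s (conjCurve hB K t)) (f (B * K - K * B)) 0 := by
  have h1 := h.comp_hasDerivAt_of_eq (0 : ℝ) (hasDerivAt_conj_exp B K)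
    (Eventually.of_forall fun t => (conjCurve hB K t).2) (by simp)
  refine h1.congr_of_eventuallyEq (Eventually.of_forall fun t => ?_)
  exact (ext_apply s (conjCurve hB K t)).symm

theorem IsSmooth.hasDerivAt {s : Twistor V → F} (hs : IsSmooth s) (K : Twistor V)
    {B : V →L[ℝ] V} (hB : B ∈ orth V) :
    HasDerivAt (fun t => s (conjCurve hB K t)) (dAlong s K (B * K - K * B)) 0 :=
  HasFDerivWithinAt.hasDerivAt_conjCurve
    ((hs K K.2).differentiableWithinAt (by simp)).hasFDerivWithinAt hB

/-- Uniqueness of derivatives in one real variable; this reduces the differentiation rules below to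
curves. -/
theorem dAlong_eq {s : Twistor V → F} (hs : IsSmooth s) {K : Twistor V} {B : V →L[ℝ] V}
    (hB : B ∈ orth V) {d : F} (h : HasDerivAt (fun t => s (conjCurve hB K t)) d 0) :
    dAlong s K (B * K - K * B) = d :=
  (hs.hasDerivAt K hB).unique h

/-- `fderivWithin` itself may fail to vary smoothly. Locally there is a smoothly varying choice of
derivatives `f'`, and it agrees with `fderivWithin` on the directions `[B,K]`, the only ones that
occur. -/
theorem isSmooth_dAlong {s : Twistor V → F} (hs : IsSmooth s) {X : Twistor V → (V →L[ℝ] V)}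
    (hX : IsSmooth X) (h : ∀ K, ∃ B ∈ orth V, X K = B * K - K * B) :
    IsSmooth fun K => dAlong s K (X K) := by
  -- Differentiation costs one order, so each finite order `m` is obtained from order `m + 1` of
  -- `s`.
  refine fun x hx => contDiffWithinAt_infty.2 fun m => ?_
  have hs' : ContDiffWithinAt ℝ ((m : WithTop ℕ∞) + 1) (ext s) (twistorSet V) x :=
    (hs x hx).of_le (by exact_mod_cast le_top)
  obtain ⟨u, hu, hut, -, f', hf', hsm⟩ :=
    (contDiffWithinAt_succ_iff_hasFDerivWithinAt' (by simp)).1 hs'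
  rw [Set.insert_eq_of_mem hx] at hu hut
  have hX' : ContDiffWithinAt ℝ m (ext X) (twistorSet V) x :=
    (hX x hx).of_le (by exact_mod_cast le_top)
  have key : ∀ y ∈ u, ext (fun K => dAlong s K (X K)) y = f' y (ext X y) := fun y hy => by
    obtain ⟨B, hB, e⟩ := h ⟨y, hut hy⟩
    have e1 := ext_apply (fun K => dAlong s K (X K)) ⟨y, hut hy⟩
    have e2 := ext_apply X ⟨y, hut hy⟩
    simp only at e1 e2
    rw [e1, e2, e]
    exact dAlong_eq hs hB (HasFDerivWithinAt.hasDerivAt_conjCurve (hf' y hy) hB)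
  exact (hsm.clm_apply hX').congr_of_eventuallyEq (Filter.mem_of_superset hu key)
    (key x (mem_of_mem_nhdsWithin hx hu))

theorem IsSmooth.mul {s t : Twistor V → (V →L[ℝ] V)} (hs : IsSmooth s) (ht : IsSmooth t) :
    IsSmooth (s * t) :=
  isSmooth_congr (ContDiffOn.mul hs ht) fun K => by simp [ext_apply]

theorem IsSmooth.clm_comp {G : Type*} [NormedAddCommGroup G] [NormedSpace ℝ G] (f : F →L[ℝ] G)
    {s : Twistor V → F} (hs : IsSmooth s) : IsSmooth fun K => f (s K) :=
  isSmooth_congr (f.contDiff.comp_contDiffOn hs) fun K => by simp [ext_apply]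

theorem IsSmooth.neg {s : Twistor V → F} (hs : IsSmooth s) : IsSmooth (-s) :=
  isSmooth_congr (ContDiffOn.neg hs) fun K => by simp [ext_apply]

theorem IsSmooth.sub {s t : Twistor V → F} (hs : IsSmooth s) (ht : IsSmooth t) :
    IsSmooth (s - t) := by
  rw [sub_eq_add_neg]
  exact hs.add ht.neg

theorem IsSmooth.continuous {s : Twistor V → F} (hs : IsSmooth s) : Continuous s := by
  have := continuousOn_iff_continuous_domRestrict.1 (ContDiffOn.continuousOn hs)
  exact this.congr fun K => ext_apply s K

theorem isSmooth_φ : IsSmooth (φ : Twistor V → (V →L[ℝ] V)) :=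
  isSmooth_congr contDiffOn_id fun _ => rfl

end Calculus

end TwistorSpace

namespace TwistorSpace

/-! ### Invariant functions and equivariant sections. -/

section Equivariant

variable {V : Type*} [NormedAddCommGroup V] [InnerProductSpace ℝ V]

/-- The smooth functions on the twistor space that are invariant under conjugation by the
invertible endomorphisms that commute with `J`. -/
def invariantFun (J : Twistor V) : Subalgebra ℝ (Twistor V → ℝ) where
  carrier := {f | IsSmooth f ∧ ∀ (u v : V →L[ℝ] V) (K L : Twistor V), u * v = 1 → v * u = 1 →
    u * J = J * u → (L : V →L[ℝ] V) = u * K * v → f L = f K}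
  mul_mem' hf hg := ⟨IsSmooth.smul hf.1 hg.1, fun u v K L h1 h2 h3 h4 => by
    simp only [Pi.mul_apply, hf.2 u v K L h1 h2 h3 h4, hg.2 u v K L h1 h2 h3 h4]⟩
  add_mem' hf hg := ⟨IsSmooth.add hf.1 hg.1, fun u v K L h1 h2 h3 h4 => by
    simp only [Pi.add_apply, hf.2 u v K L h1 h2 h3 h4, hg.2 u v K L h1 h2 h3 h4]⟩
  algebraMap_mem' c := ⟨isSmooth_const c, fun _ _ _ _ _ _ _ _ => rfl⟩

/-- The smooth sections of `End V × 𝒯` that are equivariant under conjugation by the invertible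
endomorphisms that commute with `J`. -/
def equivariantEnd [CompleteSpace V] (J : Twistor V) :
    Subalgebra ℝ (Twistor V → (V →L[ℝ] V)) where
  carrier := {s | IsSmooth s ∧ ∀ (u v : V →L[ℝ] V) (K L : Twistor V), u * v = 1 → v * u = 1 →
    u * J = J * u → (L : V →L[ℝ] V) = u * K * v → s L = u * s K * v}
  mul_mem' {s t} hs ht := ⟨hs.1.mul ht.1, fun u v K L h1 h2 h3 h4 => by
    simp only [Pi.mul_apply, hs.2 u v K L h1 h2 h3 h4, ht.2 u v K L h1 h2 h3 h4]
    calc u * s K * v * (u * t K * v) = u * s K * (v * u) * t K * v := by simp only [mul_assoc]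
      _ = _ := by rw [h2, mul_one, mul_assoc u]⟩
  add_mem' hs ht := ⟨hs.1.add ht.1, fun u v K L h1 h2 h3 h4 => by
    simp only [Pi.add_apply, hs.2 u v K L h1 h2 h3 h4, ht.2 u v K L h1 h2 h3 h4, mul_add, add_mul]⟩
  algebraMap_mem' c := ⟨isSmooth_const _, fun u v K L h1 _ _ _ => by
    simp [Algebra.algebraMap_eq_smul_one, h1]⟩

section

variable [CompleteSpace V]

theorem cst_mem_equivariantEnd (J : Twistor V) : cst J ∈ equivariantEnd J :=
  ⟨isSmooth_const _, fun u v K L h1 _ h3 _ => by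
    change (J : V →L[ℝ] V) = u * J * v
    rw [h3, mul_assoc, h1, mul_one]⟩

theorem φ_mem_equivariantEnd (J : Twistor V) : φ ∈ equivariantEnd J :=
  ⟨isSmooth_φ, fun _ _ _ _ _ _ _ h4 => h4⟩

theorem anti_mem_equivariantEnd (J : Twistor V) : anti J ∈ equivariantEnd J :=
  add_mem (mul_mem (cst_mem_equivariantEnd J) (φ_mem_equivariantEnd J))
    (mul_mem (φ_mem_equivariantEnd J) (cst_mem_equivariantEnd J))

theorem smul_mem_equivariantEnd {J : Twistor V} {f : Twistor V → ℝ}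
    {s : Twistor V → (V →L[ℝ] V)} (hf : f ∈ invariantFun J) (hs : s ∈ equivariantEnd J) :
    f • s ∈ equivariantEnd J :=
  ⟨IsSmooth.smul hf.1 hs.1, fun u v K L h1 h2 h3 h4 => by
    simp only [Pi.smul_apply', hs.2 u v K L h1 h2 h3 h4, hf.2 u v K L h1 h2 h3 h4,
      mul_smul_comm, smul_mul_assoc]⟩

theorem letters_subset_equivariantEnd (J : Twistor V) {c : Twistor V → (V →L[ℝ] V)}
    (hc : c ∈ letters J) : c ∈ equivariantEnd J := by
  rcases hc with rfl | rfl | rfl | rfl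
  · exact cst_mem_equivariantEnd J
  · exact neg_mem (cst_mem_equivariantEnd J)
  · exact φ_mem_equivariantEnd J
  · exact neg_mem (φ_mem_equivariantEnd J)

theorem sSet_subset_equivariantEnd (J : Twistor V) {S : Twistor V → (V →L[ℝ] V)}
    (hS : S ∈ sSet J) : S ∈ equivariantEnd J := by
  have h1 := cst_mem_equivariantEnd J
  have h2 := φ_mem_equivariantEnd J
  rcases hS with rfl | rfl | rfl | rfl
  · exact one_mem _
  · exact add_mem h1 h2
  · exact sub_mem h1 h2
  · exact sub_mem (mul_mem h1 h2) (mul_mem h2 h1)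

theorem polyQ_mem_equivariantEnd {J : Twistor V} {k : ℕ} {a : ℕ → Twistor V → ℝ}
    (ha : ∀ i ≤ k, a i ∈ invariantFun J) : polyQ J k a ∈ equivariantEnd J := by
  have : polyQ J k a = ∑ i ∈ Finset.range (k + 1), a i • anti J ^ i := by
    ext1 K
    simp [polyQ]
  rw [this]
  exact sum_mem fun i hi => smul_mem_equivariantEnd (ha i (by simpa [Nat.lt_succ_iff] using hi))
    (pow_mem (anti_mem_equivariantEnd J) i)

theorem commute_exp {J : Twistor V} {B : V →L[ℝ] V} (h : B * J = J * B) (t : ℝ) :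
    NormedSpace.exp (t • B) * J = J * NormedSpace.exp (t • B) :=
  (Commute.exp_left (Commute.smul_left (show Commute B (J : V →L[ℝ] V) from h) t)).eq

/-- The derivative of an equivariant section along the flow of an endomorphism that commutes
with `J`. -/
theorem dAlong_equivariant {J : Twistor V} {s : Twistor V → (V →L[ℝ] V)}
    (hs : s ∈ equivariantEnd J) {B : V →L[ℝ] V} (hB : B ∈ orth V) (h : B * J = J * B)
    (K : Twistor V) : dAlong s K (B * K - K * B) = B * s K - s K * B := by
  refine dAlong_eq hs.1 hB ((hasDerivAt_conj_exp B (s K)).congr_of_eventuallyEq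
    (Eventually.of_forall fun t => ?_))
  exact hs.2 _ _ _ _ (exp_mul_exp_neg _) (exp_neg_mul_exp _) (commute_exp h t) rfl

end

/-- A coefficient of the characteristic polynomial is a universal polynomial in the matrix entries.
These are smooth, and smooth functions form an algebra, so evaluating the polynomial inside
`smoothFun V` gives smoothness for free. -/
theorem isSmooth_charpoly_coeff [FiniteDimensional ℝ V] {s : Twistor V → (V →L[ℝ] V)}
    (hs : IsSmooth s) (i : ℕ) :
    IsSmooth fun K => (LinearMap.charpoly (s K : V →ₗ[ℝ] V)).coeff i := by
  have := FiniteDimensional.complete ℝ V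
  let b := Module.finBasis ℝ V
  let m : Fin (finrank ℝ V) × Fin (finrank ℝ V) → smoothFun V := fun p =>
    ⟨fun K => LinearMap.toMatrix b b (s K : V →ₗ[ℝ] V) p.1 p.2, by
      let f : (V →L[ℝ] V) →ₗ[ℝ] ℝ :=
        (Matrix.entryLinearMap ℝ ℝ p.1 p.2) ∘ₗ (LinearMap.toMatrix b b).toLinearMap ∘ₗ
          ContinuousLinearMap.coeLM ℝ
      exact IsSmooth.clm_comp f.toContinuousLinearMap hs⟩
  have key : (fun K => (LinearMap.charpoly (s K : V →ₗ[ℝ] V)).coeff i) =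
      (MvPolynomial.aeval m ((Matrix.charpoly.univ ℝ (Fin (finrank ℝ V))).coeff i)).1 := by
    ext K
    let ev : smoothFun V →ₐ[ℝ] ℝ := (Pi.evalAlgHom ℝ (fun _ : Twistor V => ℝ) K).comp
      (smoothFun V).val
    have h1 : ev (MvPolynomial.aeval m ((Matrix.charpoly.univ ℝ (Fin (finrank ℝ V))).coeff i)) =
        MvPolynomial.aeval (fun p => ev (m p))
          ((Matrix.charpoly.univ ℝ (Fin (finrank ℝ V))).coeff i) :=
      MvPolynomial.comp_aeval_apply ..
    refine Eq.trans ?_ h1.symm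
    have h2 := Matrix.charpoly.univ_coeff_eval₂Hom (n := Fin (finrank ℝ V))
      (f := (Algebra.ofId ℝ ℝ : ℝ →+* ℝ))
      (fun p => ev (m p)) i
    rw [← LinearMap.charpoly_toMatrix _ b]
    exact h2.symm
  rw [key]
  exact (MvPolynomial.aeval m _).2

/-- Equivariance of `{J,φ}` makes its values at `K` and `L` conjugate, and conjugate maps have the
same characteristic polynomial. -/
theorem symFun_mem_invariantFun [FiniteDimensional ℝ V] (J : Twistor V) (n j : ℕ) :
    symFun J n j ∈ invariantFun J := by
  have := FiniteDimensional.complete ℝ V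
  refine ⟨IsSmooth.smul (isSmooth_const _)
    (isSmooth_charpoly_coeff (anti_mem_equivariantEnd J).1 _), fun u v K L h1 h2 h3 h4 => ?_⟩
  have e := (anti_mem_equivariantEnd J).2 u v K L h1 h2 h3 h4
  simp only [symFun]
  congr 2
  let w : V ≃ₗ[ℝ] V := LinearEquiv.ofLinearMap (u : V →ₗ[ℝ] V) (v : V →ₗ[ℝ] V)
    (by ext x; exact DFunLike.congr_fun h1 x) (by ext x; exact DFunLike.congr_fun h2 x)
  rw [e, ← LinearEquiv.charpoly_conj w (anti J K : V →ₗ[ℝ] V)]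
  rfl

end Equivariant

end TwistorSpace

namespace TwistorSpace

/-! ### Local frames for the commutant bundle of a smooth complex structure. -/

section VectorBundle

variable {V : Type*} [NormedAddCommGroup V] [InnerProductSpace ℝ V] [CompleteSpace V]

/-- For `c` with `c² = -1`, the projection of `End V` to the commutant of `c`. -/
noncomputable def commutantProj (c : V →L[ℝ] V) : (V →L[ℝ] V) →ₗ[ℝ] (V →L[ℝ] V) where
  toFun A := (1 / 2 : ℝ) • (A - c * A * c)
  map_add' A B := by rw [← smul_add]; congr 1; noncomm_ring
  map_smul' r A := by
    rw [RingHom.id_apply, smul_comm r, smul_sub r, mul_smul_comm, smul_mul_assoc]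

theorem commutantProj_apply (c A : V →L[ℝ] V) :
    commutantProj c A = (1 / 2 : ℝ) • (A - c * A * c) := rfl

theorem norm_commutantProj_sub_le (c d A : V →L[ℝ] V) :
    ‖commutantProj c A - commutantProj d A‖ ≤ ‖c - d‖ * (‖c‖ + ‖d‖) * ‖A‖ := by
  -- Telescoping: `cAc - dAd = (c - d)Ac + dA(c - d)`.
  have e : commutantProj c A - commutantProj d A =
      (1 / 2 : ℝ) • (-((c - d) * A * c) - d * A * (c - d)) := by
    rw [commutantProj_apply, commutantProj_apply, ← smul_sub]
    congr 1
    noncomm_ring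
  rw [e, norm_smul]
  have h1 : ‖(c - d) * A * c‖ ≤ ‖c - d‖ * ‖A‖ * ‖c‖ := norm_mul₃_le
  have h2 : ‖d * A * (c - d)‖ ≤ ‖d‖ * ‖A‖ * ‖c - d‖ := norm_mul₃_le
  have h3 := norm_sub_le (-((c - d) * A * c)) (d * A * (c - d))
  rw [norm_neg] at h3
  have h4 : ‖(1 / 2 : ℝ)‖ ≤ 1 := by norm_num
  calc _ ≤ 1 * (‖c - d‖ * ‖A‖ * ‖c‖ + ‖d‖ * ‖A‖ * ‖c - d‖) := by gcongr; linarith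
    _ = _ := by ring

theorem commutantProj_eq_self {c A : V →L[ℝ] V} (hc : c * c = -1) (h : c * A = A * c) :
    commutantProj c A = A := by
  rw [commutantProj_apply, h, mul_assoc, hc, mul_neg, mul_one, sub_neg_eq_add, ← two_smul ℝ,
    smul_smul]
  norm_num

theorem commutantProj_mem_bundle {c : Twistor V → (V →L[ℝ] V)} {K : Twistor V}
    (hc : c K * c K = -1) (hs : star (c K) = -c K) {A : V →L[ℝ] V} (hA : A ∈ orth V) :
    commutantProj (c K) A ∈ bundle c c K := by
  refine ⟨?_, ?_⟩
  · refine Submodule.smul_mem _ _ (Submodule.sub_mem _ hA (mem_orth_iff_star.2 ?_))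
    rw [star_mul, star_mul, hs, mem_orth_iff_star.1 hA]
    noncomm_ring
  · rw [commutantProj_apply, mul_smul_comm, smul_mul_assoc]
    congr 1
    rw [mul_sub, sub_mul, mul_assoc _ (c K) (c K), hc, ← mul_assoc, ← mul_assoc, hc]
    noncomm_ring

/-- The projection at `K` fixes `A` and the one at `L` kills it, so `‖A‖` is at most the norm of
their difference times `‖A‖`, with a factor below 1. -/
theorem commutantProj_injOn {c : Twistor V → (V →L[ℝ] V)} {K L : Twistor V}
    (hc : c K * c K = -1) (h : ‖c K - c L‖ * (‖c K‖ + ‖c L‖) < 1) {A : V →L[ℝ] V}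
    (hA : A ∈ bundle c c K) (h0 : commutantProj (c L) A = 0) : A = 0 := by
  have h1 := norm_commutantProj_sub_le (c K) (c L) A
  rw [h0, sub_zero, commutantProj_eq_self hc hA.2] at h1
  by_contra hne
  have := norm_pos_iff.2 hne
  nlinarith

/-- A basis of the fibre at `K`, projected to the nearby fibres, is a frame: it stays independent by
injectivity, and it spans because projecting back from `L` to `K` is injective too, which bounds the
dimension of the fibre at `L`. -/
theorem isVectorBundle_bundle [FiniteDimensional ℝ V] {c : Twistor V → (V →L[ℝ] V)}
    (hsm : IsSmooth c) (hc : ∀ K, c K * c K = -1) (hs : ∀ K, star (c K) = -c K) :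
    IsVectorBundle (bundle c c) := by
  intro K
  let b := Module.finBasis ℝ (bundle c c K)
  refine ⟨finrank ℝ (bundle c c K), fun i => ⟨fun L => commutantProj (c L) (b i), ?_, fun L =>
    commutantProj_mem_bundle (hc L) (hs L) (b i).2.1⟩, ?_⟩
  · exact (isSmooth_const (1 / 2 : ℝ)).smul
      ((isSmooth_const (b i : V →L[ℝ] V)).sub ((hsm.mul (isSmooth_const _)).mul hsm))
  have hcont := hsm.continuous
  have hlim : Tendsto (fun L => ‖c K - c L‖ * (‖c K‖ + ‖c L‖)) (𝓝 K) (𝓝 0) := by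
    have h : Continuous (fun L => ‖c K - c L‖ * (‖c K‖ + ‖c L‖)) := by fun_prop
    simpa using h.tendsto K
  filter_upwards [hlim.eventually_lt_const one_pos] with L hL
  have hL' : ‖c L - c K‖ * (‖c L‖ + ‖c K‖) < 1 := by rwa [norm_sub_rev, add_comm]
  have hli : LinearIndependent ℝ fun i => commutantProj (c L) (b i) := by
    refine b.linearIndependent.map' ((commutantProj (c L)).comp (bundle c c K).subtype)
      (LinearMap.ker_eq_bot'.2 fun A hA => ?_)
    exact Subtype.ext (commutantProj_injOn (hc K) hL A.2 hA)
  refine ⟨hli, Submodule.eq_of_le_of_finrank_le ?_ ?_⟩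
  · rw [Submodule.span_le]
    rintro _ ⟨i, rfl⟩
    exact commutantProj_mem_bundle (hc L) (hs L) (b i).2.1
  · rw [finrank_span_eq_card hli, Fintype.card_fin]
    refine LinearMap.finrank_le_finrank_of_injective
      (f := ((commutantProj (c K)).comp (bundle c c L).subtype).codRestrict (bundle c c K)
        fun A => commutantProj_mem_bundle (hc K) (hs K) A.2.1)
      (LinearMap.ker_eq_bot.1 (LinearMap.ker_eq_bot'.2 fun A hA => ?_))
    exact Subtype.ext (commutantProj_injOn (hc L) hL' A.2 (congr_arg Subtype.val hA))

end VectorBundle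

/-! ### Construction of the bracket and the algebroid axioms. -/

section Bracket

variable {V : Type*} [NormedAddCommGroup V] [InnerProductSpace ℝ V] [CompleteSpace V]

/-- The properties of `F = QS` and of the letter `c` with `JF = Fc` and `FJ = cF` on which the
construction of the bracket depends. -/
structure Intertwines (J : Twistor V) (F c : Twistor V → (V →L[ℝ] V)) : Prop where
  equivariant : F ∈ equivariantEnd J
  letter_equivariant : c ∈ equivariantEnd J
  letter_sq : ∀ K, c K * c K = -1
  letter_star : ∀ K, star (c K) = -c K
  left : ∀ K, (J : V →L[ℝ] V) * F K = F K * c K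
  right : ∀ K, F K * (J : V →L[ℝ] V) = c K * F K
  star_eq : ∃ ε : ℝ, ε * ε = 1 ∧ ∀ K, star (F K) = ε • F K

/-- The bracket on the sections of `E^S`, as a section of `End V × 𝒯`. -/
noncomputable def bracketFun (F A B : Twistor V → (V →L[ℝ] V)) : Twistor V → (V →L[ℝ] V) :=
  fun K => dAlong B K (anchor F K (A K)) - dAlong A K (anchor F K (B K))
    - (F K * A K * F K * B K - B K * (F K * A K * F K))
    + (F K * B K * F K * A K - A K * (F K * B K * F K))
    + (A K * F K * F K * B K - B K * F K * F K * A K)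

theorem bracketFun_skew (F A B : Twistor V → (V →L[ℝ] V)) :
    bracketFun F A B = -bracketFun F B A := by
  ext1 K
  simp only [bracketFun, Pi.neg_apply]
  abel

namespace Intertwines

variable {J : Twistor V} {F c : Twistor V → (V →L[ℝ] V)}

/-- The sign `ε` of `F* = εF` occurs twice and cancels. -/
theorem conj_mem_orth (h : Intertwines J F c) (K : Twistor V) {A : V →L[ℝ] V} (hA : A ∈ orth V) :
    F K * A * F K ∈ orth V := by
  obtain ⟨ε, hε, hs⟩ := h.star_eq
  rw [mem_orth_iff_star] at hA ⊢
  rw [star_mul, star_mul, hs, hA]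
  simp only [smul_mul_assoc, mul_smul_comm, smul_smul, hε, one_smul]
  noncomm_ring

/-- The letter is moved through: `FAFJ = FAcF = FcAF = JFAF`. With `conj_mem_orth`, this puts `FAF`
in `𝔲(V,J)`. -/
theorem conj_comm (h : Intertwines J F c) {K : Twistor V} {A : V →L[ℝ] V} (hA : A ∈ bundle c c K) :
    F K * A * F K * J = J * (F K * A * F K) := by
  calc F K * A * F K * J = F K * (A * c K) * F K := by
        rw [mul_assoc _ (F K) (J : V →L[ℝ] V), h.right]; simp only [mul_assoc]
    _ = F K * c K * A * F K := by rw [← hA.2]; simp only [mul_assoc]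
    _ = _ := by rw [← h.left]; simp only [mul_assoc]

theorem isSmooth_anchor (h : Intertwines J F c) {A : Twistor V → (V →L[ℝ] V)} (hA : IsSmooth A) :
    IsSmooth fun K => anchor F K (A K) := by
  have h1 := (h.equivariant.1.mul hA).mul h.equivariant.1
  exact (h1.mul isSmooth_φ).sub (isSmooth_φ.mul h1)

theorem anchor_mem_tangent (h : Intertwines J F c)
    {K : Twistor V} {A : V →L[ℝ] V} (hA : A ∈ bundle c c K) :
    anchor F K A ∈ tangent K := by
  have hm := mem_orth_iff_star.1 (h.conj_mem_orth K hA.1)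
  change F K * A * F K * K - K * (F K * A * F K) ∈ tangent K
  refine ⟨mem_orth_iff_star.2 ?_, ?_⟩
  · rw [star_sub, star_mul _ (K : V →L[ℝ] V), star_mul (K : V →L[ℝ] V), hm, star_twistor]
    noncomm_ring
  · rw [sub_mul, mul_sub, mul_assoc _ (K : V →L[ℝ] V) K, sq_eq, ← mul_assoc (K : V →L[ℝ] V) K,
      sq_eq]
    noncomm_ring

/-- By definition `anchor F K A` is the commutator of `FAF` with `K`, the initial velocity of the
conjugation curve of `FAF`. -/
theorem hasDerivAt_section (h : Intertwines J F c)
    {s : Twistor V → (V →L[ℝ] V)} (hs : IsSmooth s) {K : Twistor V}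
    {A : V →L[ℝ] V} (hA : A ∈ bundle c c K) :
    HasDerivAt (fun t => s (conjCurve (h.conj_mem_orth K hA.1) K t))
      (dAlong s K (anchor F K A)) 0 :=
  hs.hasDerivAt K (h.conj_mem_orth K hA.1)

theorem hasDerivAt_equivariant (h : Intertwines J F c)
    {s : Twistor V → (V →L[ℝ] V)} (hs : s ∈ equivariantEnd J)
    {K : Twistor V} {A : V →L[ℝ] V} (hA : A ∈ bundle c c K) :
    HasDerivAt (fun t => s (conjCurve (h.conj_mem_orth K hA.1) K t))
      (F K * A * F K * s K - s K * (F K * A * F K)) 0 := by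
  rw [← dAlong_equivariant hs (h.conj_mem_orth K hA.1) (h.conj_comm hA)]
  exact hs.1.hasDerivAt K _

/-- Differentiate `B* = -B` along the curve. -/
theorem dAlong_mem_orth (h : Intertwines J F c)
    {B : Twistor V → (V →L[ℝ] V)} (hB : B ∈ Sections (bundle c c))
    {K : Twistor V} {A : V →L[ℝ] V} (hA : A ∈ bundle c c K) :
    dAlong B K (anchor F K A) ∈ orth V := by
  have h1 := h.hasDerivAt_section hB.1 hA
  refine mem_orth_iff_star.2 (h1.star.unique (h1.neg.congr_of_eventuallyEq
    (Eventually.of_forall fun t => ?_)))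
  exact mem_orth_iff_star.1 (hB.2 _).1

/-- The fibre of the commutant of `c` moves with `c`. Differentiating `cB = Bc`, where `c` has
derivative `[X,c]` with `X = FAF`, shows that subtracting `[X,B]` corrects exactly for this motion.
-/
theorem dAlong_comm (h : Intertwines J F c)
    {B : Twistor V → (V →L[ℝ] V)} (hB : B ∈ Sections (bundle c c))
    {K : Twistor V} {A : V →L[ℝ] V} (hA : A ∈ bundle c c K) :
    c K * (dAlong B K (anchor F K A) - (F K * A * F K * B K - B K * (F K * A * F K))) =
      (dAlong B K (anchor F K A) - (F K * A * F K * B K - B K * (F K * A * F K))) * c K := by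
  have h1 := h.hasDerivAt_section hB.1 hA
  have h2 := h.hasDerivAt_equivariant h.letter_equivariant hA
  have h3 := (h2.mul h1).unique ((h1.mul h2).congr_of_eventuallyEq
    (Eventually.of_forall fun t => (hB.2 _).2))
  simp only [conjCurve_zero] at h3
  have h4 := (hB.2 K).2
  clear h1 h2
  generalize dAlong B K (anchor F K A) = D at *
  generalize F K * A * F K = X at *
  generalize B K = b at *
  generalize c K = c at *
  -- A form of the Jacobi identity: the commutator in question is the differentiated relation `h3`
  -- plus a commutator of `[c,b] = 0` with `X`.
  have h5 : c * (D - (X * b - b * X)) - (D - (X * b - b * X)) * c =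
      ((X * c - c * X) * b + c * D) - (D * c + b * (X * c - c * X))
        + ((c * b - b * c) * X - X * (c * b - b * c)) := by noncomm_ring
  rw [h3, h4, sub_self, sub_self] at h5
  rw [← sub_eq_zero, h5]
  simp

theorem bracketFun_mem (h : Intertwines J F c)
    {A B : Twistor V → (V →L[ℝ] V)} (hA : A ∈ Sections (bundle c c))
    (hB : B ∈ Sections (bundle c c)) : bracketFun F A B ∈ Sections (bundle c c) := by
  have hF := h.equivariant.1
  refine ⟨?_, fun K => ⟨?_, ?_⟩⟩
  · have hd : ∀ {A B : Twistor V → (V →L[ℝ] V)}, A ∈ Sections (bundle c c) →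
        B ∈ Sections (bundle c c) → IsSmooth fun K => dAlong B K (anchor F K (A K)) :=
      fun {A B} hA hB => isSmooth_dAlong hB.1 (h.isSmooth_anchor hA.1) fun K =>
        ⟨_, h.conj_mem_orth K (hA.2 K).1, rfl⟩
    have hc : ∀ {A B : Twistor V → (V →L[ℝ] V)}, A ∈ Sections (bundle c c) →
        B ∈ Sections (bundle c c) → IsSmooth (F * A * F * B - B * (F * A * F)) :=
      fun {A B} hA hB => (((hF.mul hA.1).mul hF).mul hB.1).sub (hB.1.mul ((hF.mul hA.1).mul hF))
    exact ((((hd hA hB).sub (hd hB hA)).sub (hc hA hB)).add (hc hB hA)).add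
      ((((hA.1.mul hF).mul hF).mul hB.1).sub (((hB.1.mul hF).mul hF).mul hA.1))
  · have hc : ∀ {X Y : V →L[ℝ] V}, X ∈ orth V → Y ∈ orth V → X * Y - Y * X ∈ orth V := by
      intro X Y hX hY
      rw [mem_orth_iff_star] at *
      rw [star_sub, star_mul, star_mul, hX, hY]
      noncomm_ring
    obtain ⟨ε, hε, hs⟩ := h.star_eq
    refine add_mem (add_mem (sub_mem (sub_mem (h.dAlong_mem_orth hB (hA.2 K))
      (h.dAlong_mem_orth hA (hB.2 K))) (hc (h.conj_mem_orth K (hA.2 K).1) (hB.2 K).1))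
      (hc (h.conj_mem_orth K (hB.2 K).1) (hA.2 K).1)) ?_
    have hA' := mem_orth_iff_star.1 (hA.2 K).1
    have hB' := mem_orth_iff_star.1 (hB.2 K).1
    rw [mem_orth_iff_star]
    simp only [star_sub, star_mul, hs, hA', hB', smul_mul_assoc, mul_smul_comm, smul_smul, hε,
      one_smul]
    noncomm_ring
  · have h1 := h.dAlong_comm hB (hA.2 K)
    have h2 := h.dAlong_comm hA (hB.2 K)
    -- `F²` commutes with `c` because `cFF = FJF = FFc`; hence so does `AF²B`.
    have hFF : c K * F K * F K = F K * F K * c K := by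
      rw [← h.right, mul_assoc, h.left, mul_assoc]
    have h3 : ∀ {X Y : V →L[ℝ] V}, X ∈ bundle c c K → Y ∈ bundle c c K →
        c K * (X * F K * F K * Y) = X * F K * F K * Y * c K := fun {X Y} hX hY =>
      calc c K * (X * F K * F K * Y) = (c K * X) * F K * F K * Y := by simp only [mul_assoc]
        _ = X * (c K * F K * F K) * Y := by rw [hX.2]; simp only [mul_assoc]
        _ = X * F K * F K * (c K * Y) := by rw [hFF]; simp only [mul_assoc]
        _ = _ := by rw [hY.2]; simp only [mul_assoc]
    have h4 := h3 (hA.2 K) (hB.2 K)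
    have h5 := h3 (hB.2 K) (hA.2 K)
    have e : bracketFun F A B K =
        (dAlong B K (anchor F K (A K)) - (F K * A K * F K * B K - B K * (F K * A K * F K))) -
        (dAlong A K (anchor F K (B K)) - (F K * B K * F K * A K - A K * (F K * B K * F K))) +
        (A K * F K * F K * B K - B K * F K * F K * A K) := by
      rw [bracketFun]
      abel
    rw [e]
    exact ((Commute.sub_right h1 h2).add_right (Commute.sub_right h4 h5)).eq

theorem dAlong_add (h : Intertwines J F c) {A B : Twistor V → (V →L[ℝ] V)} (hA : IsSmooth A)
    (hB : IsSmooth B) {K : Twistor V} {X : V →L[ℝ] V} (hX : X ∈ bundle c c K) :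
    dAlong (A + B) K (anchor F K X) =
      dAlong A K (anchor F K X) + dAlong B K (anchor F K X) :=
  dAlong_eq (hA.add hB) (h.conj_mem_orth K hX.1)
    ((h.hasDerivAt_section hA hX).add (h.hasDerivAt_section hB hX))

theorem dAlong_smul (h : Intertwines J F c)
    {f : Twistor V → ℝ} {B : Twistor V → (V →L[ℝ] V)} (hf : IsSmooth f)
    (hB : IsSmooth B) {K : Twistor V} {X : V →L[ℝ] V} (hX : X ∈ bundle c c K) :
    dAlong (f • B) K (anchor F K X) =
      f K • dAlong B K (anchor F K X) + dAlong f K (anchor F K X) • B K := by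
  have h1 := (hf.hasDerivAt K (h.conj_mem_orth K hX.1)).smul (h.hasDerivAt_section hB hX)
  simp only [conjCurve_zero] at h1
  exact dAlong_eq (hf.smul hB) (h.conj_mem_orth K hX.1) h1

theorem dAlong_const_smul (h : Intertwines J F c) (r : ℝ) {B : Twistor V → (V →L[ℝ] V)}
    (hB : IsSmooth B) {K : Twistor V} {X : V →L[ℝ] V} (hX : X ∈ bundle c c K) :
    dAlong (r • B) K (anchor F K X) = r • dAlong B K (anchor F K X) :=
  dAlong_eq ((isSmooth_const r).smul hB) (h.conj_mem_orth K hX.1)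
    ((h.hasDerivAt_section hB hX).const_smul r)

theorem bracketFun_add_right (h : Intertwines J F c)
    {A B C : Twistor V → (V →L[ℝ] V)} (hA : A ∈ Sections (bundle c c))
    (hB : B ∈ Sections (bundle c c)) (hC : C ∈ Sections (bundle c c)) :
    bracketFun F A (B + C) = bracketFun F A B + bracketFun F A C := by
  ext1 K
  simp only [bracketFun, Pi.add_apply, h.dAlong_add hB.1 hC.1 (hA.2 K), map_add, mul_add, add_mul]
  -- Additivity in the direction is just linearity of `fderivWithin`; additivity in the section
  -- needed the curves.
  rw [show dAlong A K (anchor F K (B K) + anchor F K (C K)) = _ from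
    map_add (fderivWithin ℝ (ext A) (twistorSet V) K) _ _]
  simp only [dAlong]
  abel

theorem bracketFun_smul_fun_right (h : Intertwines J F c)
    {A B : Twistor V → (V →L[ℝ] V)} {f : Twistor V → ℝ}
    (hf : IsSmooth f) (hA : A ∈ Sections (bundle c c)) (hB : B ∈ Sections (bundle c c)) :
    bracketFun F A (f • B) =
      fun K => f K • bracketFun F A B K + dAlong f K (anchor F K (A K)) • B K := by
  ext1 K
  simp only [bracketFun, Pi.smul_apply', h.dAlong_smul hf hB.1 (hA.2 K), map_smul, mul_smul_comm,
    smul_mul_assoc, smul_add, smul_sub]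
  rw [show dAlong A K (f K • anchor F K (B K)) = _ from
    map_smul (fderivWithin ℝ (ext A) (twistorSet V) K) _ _]
  simp only [dAlong]
  abel

theorem bracketFun_smul_right (h : Intertwines J F c) {A B : Twistor V → (V →L[ℝ] V)} (r : ℝ)
    (hA : A ∈ Sections (bundle c c)) (hB : B ∈ Sections (bundle c c)) :
    bracketFun F A (r • B) = r • bracketFun F A B := by
  ext1 K
  simp only [bracketFun, Pi.smul_apply, h.dAlong_const_smul r hB.1 (hA.2 K), map_smul,
    mul_smul_comm, smul_mul_assoc, smul_add, smul_sub]
  rw [show dAlong A K (r • anchor F K (B K)) = _ from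
    map_smul (fderivWithin ℝ (ext A) (twistorSet V) K) _ _]
  simp only [dAlong]

/-- The product rule for `[FBF,φ]`: `F` and `φ` change by their commutator with `X = FAF`. Writing
`dB = (dB - [X,B]) + [X,B]` makes every factor change by `[X, ·]`, so the whole product does, up to
`ψ` of the remainder. -/
theorem dAlong_anchor (h : Intertwines J F c)
    {A B : Twistor V → (V →L[ℝ] V)} (hA : A ∈ Sections (bundle c c))
    (hB : B ∈ Sections (bundle c c)) (K : Twistor V) :
    dAlong (fun L => anchor F L (B L)) K (anchor F K (A K)) =
      anchor F K (dAlong B K (anchor F K (A K))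
        - (F K * A K * F K * B K - B K * (F K * A K * F K)))
      + (F K * A K * F K * anchor F K (B K) - anchor F K (B K) * (F K * A K * F K)) := by
  have h1 := h.hasDerivAt_section hB.1 (hA.2 K)
  have h2 := h.hasDerivAt_equivariant h.equivariant (hA.2 K)
  have h3 := h.hasDerivAt_equivariant (φ_mem_equivariantEnd J) (hA.2 K)
  have h4 := (h2.mul h1).mul h2
  have h5 := dAlong_eq (h.isSmooth_anchor hB.1) (h.conj_mem_orth K (hA.2 K).1)
    ((h4.mul h3).sub (h3.mul h4))
  refine h5.trans ?_
  simp only [conjCurve_zero, Pi.mul_apply, anchor, LinearMap.coe_mk, AddHom.coe_mk]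
  generalize dAlong B K _ = D
  generalize F K * A K * F K = X
  noncomm_ring

/-- After `dAlong_anchor` the derivatives cancel, and what is left is the Jacobi identity for `FAF`,
`FBF` and `φ`; the term `AF²B - BF²A` supplies `[FAF,FBF]`. -/
theorem anchor_bracketFun (h : Intertwines J F c)
    {A B : Twistor V → (V →L[ℝ] V)} (hA : A ∈ Sections (bundle c c))
    (hB : B ∈ Sections (bundle c c)) :
    (fun K => anchor F K (bracketFun F A B K)) =
      lieBracket (fun K => anchor F K (A K)) (fun K => anchor F K (B K)) := by
  ext1 K
  rw [lieBracket, h.dAlong_anchor hA hB, h.dAlong_anchor hB hA, bracketFun]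
  generalize dAlong B K _ = D
  generalize dAlong A K _ = E
  simp only [anchor, LinearMap.coe_mk, AddHom.coe_mk]
  noncomm_ring

/-- The bracket on the sections of `E^S`. -/
noncomputable def bracket (h : Intertwines J F c)
    : Sections (bundle c c) →ₗ[ℝ] Sections (bundle c c) →ₗ[ℝ]
    Sections (bundle c c) :=
  LinearMap.mk₂ ℝ (fun A B => ⟨bracketFun F A.1 B.1, h.bracketFun_mem A.2 B.2⟩)
    (fun A B C => Subtype.ext (by
      change bracketFun F (A.1 + B.1) C.1 = bracketFun F A.1 C.1 + bracketFun F B.1 C.1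
      rw [bracketFun_skew, h.bracketFun_add_right C.2 A.2 B.2, neg_add, ← bracketFun_skew,
        ← bracketFun_skew]))
    (fun r A B => Subtype.ext (by
      change bracketFun F (r • A.1) B.1 = r • bracketFun F A.1 B.1
      rw [bracketFun_skew, h.bracketFun_smul_right r B.2 A.2, ← smul_neg, ← bracketFun_skew]))
    (fun A B C => Subtype.ext (h.bracketFun_add_right A.2 B.2 C.2))
    (fun r A B => Subtype.ext (h.bracketFun_smul_right r A.2 B.2))

theorem isSkewAlgebroid (h : Intertwines J F c) [FiniteDimensional ℝ V] :
    IsSkewAlgebroid (bundle c c) h.bracket (anchor F) where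
  isVectorBundle :=
    isVectorBundle_bundle h.letter_equivariant.1 h.letter_sq h.letter_star
  anchor_mem _ _ hA := h.anchor_mem_tangent hA
  anchor_smooth A := h.isSmooth_anchor A.2.1
  skew A B := Subtype.ext (bracketFun_skew F A.1 B.1)
  anchor_bracket A B := h.anchor_bracketFun A.2 B.2
  leibniz A B f := h.bracketFun_smul_fun_right f.2 A.2 B.2

end Intertwines

end Bracket

end TwistorSpace

namespace TwistorSpace

/-! ### The section `F = QS` satisfies the intertwining conditions. -/

section Letters

variable {V : Type*} [NormedAddCommGroup V] [InnerProductSpace ℝ V]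

/-- By uniqueness of the two letters the infimum runs over a single pair. This is where the
dimension bound enters. -/
theorem bundleS_eq (hdim : 4 ≤ finrank ℝ V) (J : Twistor V) {S c : Twistor V → (V →L[ℝ] V)}
    (hS : S ∈ sSet J) (hc : c ∈ letters J) (h1 : cst J * S = S * c) (h2 : S * cst J = c * S) :
    bundleS J S (cst J) (cst J) = bundle c c := by
  have hJ : cst J ∈ letters J := Or.inl rfl
  ext1 K
  apply le_antisymm
  · exact iInf₂_le_of_le c hc (iInf₂_le_of_le c hc (iInf₂_le_of_le h1 h2 le_rfl))
  · refine le_iInf₂ fun γ hγ => le_iInf₂ fun δ hδ => le_iInf₂ fun e1 e2 => ?_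
    rw [(existsUnique_left hdim J hS hJ).unique ⟨hγ, e1⟩ ⟨hc, h1⟩,
      (existsUnique_right hdim J hS hJ).unique ⟨hδ, e2⟩ ⟨hc, h2⟩]

theorem letters_sq (J : Twistor V) {c : Twistor V → (V →L[ℝ] V)} (hc : c ∈ letters J)
    (K : Twistor V) : c K * c K = -1 := by
  rcases hc with rfl | rfl | rfl | rfl <;> simp [cst, φ, sq_eq]

theorem letters_star [CompleteSpace V] (J : Twistor V) {c : Twistor V → (V →L[ℝ] V)}
    (hc : c ∈ letters J) (K : Twistor V) : star (c K) = -c K := by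
  rcases hc with rfl | rfl | rfl | rfl <;> simp [cst, φ, star_twistor]

theorem polyQ_comm_of_anti {J : Twistor V} (k : ℕ) (a : ℕ → Twistor V → ℝ) {K : Twistor V}
    {A : V →L[ℝ] V} (h : Commute (anti J K) A) : Commute (polyQ J k a K) A :=
  Commute.sum_left _ _ _ fun i _ => (h.pow_left i).smul_left _

/-- Both products equal `JKJ - K`, since `J² = -1`. -/
theorem anti_commute_cst (J K : Twistor V) : Commute (anti J K) (cst J K) := by
  change (J * K + K * J : V →L[ℝ] V) * J = J * (J * K + K * J)
  rw [add_mul, mul_add, mul_assoc (K : V →L[ℝ] V), sq_eq, ← mul_assoc (J : V →L[ℝ] V) J, sq_eq]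
  noncomm_ring

theorem anti_commute_φ (J K : Twistor V) : Commute (anti J K) (φ K) := by
  change (J * K + K * J : V →L[ℝ] V) * K = K * (J * K + K * J)
  rw [add_mul, mul_add, mul_assoc (J : V →L[ℝ] V), sq_eq, ← mul_assoc (K : V →L[ℝ] V) K, sq_eq]
  noncomm_ring

theorem anti_commute_letters (J K : Twistor V) {c : Twistor V → (V →L[ℝ] V)}
    (hc : c ∈ letters J) : Commute (anti J K) (c K) := by
  have h1 := anti_commute_cst J K
  have h2 := anti_commute_φ J K
  rcases hc with rfl | rfl | rfl | rfl
  exacts [h1, h1.neg_right, h2, h2.neg_right]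

theorem anti_commute_sSet (J K : Twistor V) {S : Twistor V → (V →L[ℝ] V)}
    (hS : S ∈ sSet J) : Commute (anti J K) (S K) := by
  have h1 := anti_commute_cst J K
  have h2 := anti_commute_φ J K
  rcases hS with rfl | rfl | rfl | rfl
  exacts [Commute.one_right _, h1.add_right h2, h1.sub_right h2,
    (h1.mul_right h2).sub_right (h2.mul_right h1)]

theorem star_polyQ [CompleteSpace V] (J : Twistor V) (k : ℕ) (a : ℕ → Twistor V → ℝ)
    (K : Twistor V) : star (polyQ J k a K) = polyQ J k a K := by
  have h : star (anti J K) = anti J K := by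
    change star (J * K + K * J : V →L[ℝ] V) = J * K + K * J
    rw [star_add, star_mul, star_mul, star_twistor, star_twistor]
    noncomm_ring
  simp only [polyQ, star_sum, star_smul, star_pow, h, star_trivial]

/-- The identity is self-adjoint, while `J ± φ` and `[J,φ]` are skew because `J` and `φ` are. -/
theorem exists_star_sSet [CompleteSpace V] (J : Twistor V) {S : Twistor V → (V →L[ℝ] V)}
    (hS : S ∈ sSet J) : ∃ ε : ℝ, ε * ε = 1 ∧ ∀ K, star (S K) = ε • S K := by
  rcases hS with rfl | rfl | rfl | rfl
  · exact ⟨1, by norm_num, fun K => by simp⟩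
  · refine ⟨-1, by norm_num, fun K => ?_⟩
    simp [cst, φ, star_twistor, add_comm]
  · refine ⟨-1, by norm_num, fun K => ?_⟩
    simp [cst, φ, star_twistor, add_comm, sub_eq_add_neg]
  · refine ⟨-1, by norm_num, fun K => ?_⟩
    simp [cst, φ, star_twistor]

theorem intertwines [FiniteDimensional ℝ V] [CompleteSpace V] (n : ℕ) (J : Twistor V)
    {S c : Twistor V → (V →L[ℝ] V)} (hS : S ∈ sSet J) (k : ℕ) (a : ℕ → Twistor V → ℝ)
    (ha : ∀ i ≤ k, a i ∈ Algebra.adjoin ℝ (symFun J n '' Set.Icc 1 (2 * n)))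
    (hc : c ∈ letters J) (h1 : cst J * S = S * c) (h2 : S * cst J = c * S) :
    Intertwines J (polyQ J k a * S) c where
  equivariant := by
    -- The coefficients `a i` are polynomials in the `f_j`, hence inherit their invariance and
    -- smoothness.
    have hle : Algebra.adjoin ℝ (symFun J n '' Set.Icc 1 (2 * n)) ≤ invariantFun J :=
      Algebra.adjoin_le (by rintro _ ⟨j, -, rfl⟩; exact symFun_mem_invariantFun J n j)
    exact mul_mem (polyQ_mem_equivariantEnd fun i hi => hle (ha i hi))
      (sSet_subset_equivariantEnd J hS)
  letter_equivariant := letters_subset_equivariantEnd J hc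
  letter_sq := letters_sq J hc
  letter_star := letters_star J hc
  left K := by
    have e : (J : V →L[ℝ] V) * S K = S K * c K := congr_fun h1 K
    have q := (polyQ_comm_of_anti k a (anti_commute_cst J K)).eq
    change (J : V →L[ℝ] V) * (polyQ J k a K * S K) = polyQ J k a K * S K * c K
    rw [mul_assoc, ← e, ← mul_assoc, ← mul_assoc]
    exact congr_arg (· * S K) q.symm
  right K := by
    have e : S K * (J : V →L[ℝ] V) = c K * S K := congr_fun h2 K
    have q := (polyQ_comm_of_anti k a (anti_commute_letters J K hc)).eq
    change polyQ J k a K * S K * (J : V →L[ℝ] V) = c K * (polyQ J k a K * S K)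
    rw [mul_assoc, e, ← mul_assoc, ← mul_assoc, q]
  star_eq := by
    obtain ⟨ε, hε, hs⟩ := exists_star_sSet J hS
    refine ⟨ε, hε, fun K => ?_⟩
    change star (polyQ J k a K * S K) = ε • (polyQ J k a K * S K)
    rw [star_mul, hs, star_polyQ, smul_mul_assoc,
      (polyQ_comm_of_anti k a (anti_commute_sSet J K hS)).eq]

end Letters

end TwistorSpace

theorem theorem4p3 {V : Type*} [NormedAddCommGroup V] [InnerProductSpace ℝ V]
    [FiniteDimensional ℝ V] (n : ℕ) (hn : 2 ≤ n) (hdim : Module.finrank ℝ V = 2 * n)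
    (J : Twistor V)
    (S : Twistor V → (V →L[ℝ] V)) (hS : S ∈ sSet J)
    (k : ℕ) (a : ℕ → Twistor V → ℝ)
    (ha : ∀ i ≤ k, a i ∈ Algebra.adjoin ℝ (symFun J n '' Set.Icc 1 (2 * n))) :
    ∃ br : Sections (bundleS J S (cst J) (cst J)) →ₗ[ℝ]
        Sections (bundleS J S (cst J) (cst J)) →ₗ[ℝ] Sections (bundleS J S (cst J) (cst J)),
      IsSkewAlgebroid (bundleS J S (cst J) (cst J)) br (anchor (polyQ J k a * S)) := by
  have := FiniteDimensional.complete ℝ V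
  -- One `c` serves as both `γ̃` and `δ̃`, which is what turns `E^S` into a commutant bundle.
  obtain ⟨c, hc, h1, h2⟩ := exists_tilde J hS (Or.inl rfl : cst J ∈ letters J)
  rw [bundleS_eq (by omega) J hS hc h1 h2]
  exact ⟨_, (intertwines n J hS k a ha hc h1 h2).isSkewAlgebroid⟩
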